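/- Let $\Psi=\{f_1,\dots,f_N\}$, $N\ge 2$, be contracting similitudes of $\mathbb{R}^n$ with ratios $r_1,\dots,r_N\in(0,1)$, and let $E$ be the attractor of $\Psi$, i.e. the nonempty compact set with $E=\bigcup_{i=1}^N f_i(E)$. Assume the strong separation condition: $f_i(E)\cap f_j(E)=\emptyset$ for all $i\ne j$. Put $r_{\min}=\min_i r_i$ and $c=\min_{i\neq j}\operatorname{dist}(f_i(E),f_j(E))>0$, and let $s$ be the similarity dimension, $\sum_{i=1}^N r_i^s=1$. Let $\mu$ be the natural self-similar measure, i.e. the Borel probability measure with $\mu(f_{i_1}\circ\cdots\circ f_{i_k}(E))=(r_{i_1}\cdots r_{i_k})^s$ for all $k\ge 0$ and $i_1,\dots,i_k\in\{1,\dots,N\}$. For $x\in E$ and $d>0$ put $h(x,d)=(2d)^s/\mu(B(x,d))$, where $B(x,d)$ is the closed Euclidean ball with centre $x$ and radius $d$. For $A\subset\mathbb{R}^n$ and $\delta>0$ let $P^s_\delta(A)$ be the supremum of $\sum_i |B_i|^s$ over all countable families of pairwise disjoint closed balls $B_i$ centred in $A$ with diameters $|B_i|\le\delta$; let $P^s_0(A)=\lim_{\delta\to0}P^s_\delta(A)$,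 and let $P^s(A)=\inf\{\sum_{i=1}^\infty P^s_0(U_i): A\subset\bigcup_{i=1}^\infty U_i\}$ be the packing measure. Then, for every $a\in(0,c/r_{\min}]$, $$P^s(E)=\max\{h(x,d): x\in E,\ 0<d\le a\}=\max\{h(x,d): x\in E,\ a\,r_{\min}\le d\le a\};$$ in particular both maxima are attained. -/

import Mathlib

open MeasureTheory Filter Topology Set
open scoped ENNReal

noncomputable section

/-- A system `f₁, …, f_N` of contracting similitudes of `ℝⁿ`, with ratios `r₁, …, r_N ∈ (0,1)`. -/
structure SimilitudeSystem (n N : ℕ) where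
  /-- the similitudes -/
  map : Fin N → EuclideanSpace ℝ (Fin n) → EuclideanSpace ℝ (Fin n)
  /-- their similarity ratios -/
  ratio : Fin N → ℝ
  ratio_pos : ∀ i, 0 < ratio i
  ratio_lt_one : ∀ i, ratio i < 1
  dist_map : ∀ i x y, dist (map i x) (map i y) = ratio i * dist x y

namespace SimilitudeSystem

variable {n N : ℕ}

/-- `E` is the self-similar set (attractor) of the system: the nonempty compact set with
`E = ⋃ i, f_i(E)`. -/
structure IsAttractor (Ψ : SimilitudeSystem n N) (E : Set (EuclideanSpace ℝ (Fin n))) : Prop where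
  nonempty : E.Nonempty
  isCompact : IsCompact E
  eq_iUnion : E = ⋃ i, Ψ.map i '' E

/-- The strong separation condition: the first-level cylinders `f_i(E)` are pairwise disjoint. -/
def StrongSeparation (Ψ : SimilitudeSystem n N) (E : Set (EuclideanSpace ℝ (Fin n))) : Prop :=
  ∀ i j, i ≠ j → Disjoint (Ψ.map i '' E) (Ψ.map j '' E)

/-- `r_min`, the smallest similarity ratio. -/
def ratioMin (Ψ : SimilitudeSystem n N) : ℝ := ⨅ i, Ψ.ratio i

/-- The distance separating two sets, `inf {dist x y : x ∈ A, y ∈ B}`. -/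
def setDist (A B : Set (EuclideanSpace ℝ (Fin n))) : ℝ :=
  ⨅ p : A × B, dist (p.1 : EuclideanSpace ℝ (Fin n)) (p.2 : EuclideanSpace ℝ (Fin n))

/-- `c`, the minimal distance between two distinct first-level cylinders. -/
def gap (Ψ : SimilitudeSystem n N) (E : Set (EuclideanSpace ℝ (Fin n))) : ℝ :=
  ⨅ p : {p : Fin N × Fin N // p.1 ≠ p.2}, setDist (Ψ.map p.1.1 '' E) (Ψ.map p.1.2 '' E)

/-- `f_w = f_{w₁} ∘ ⋯ ∘ f_{w_k}` for a word `w = w₁ ⋯ w_k`. -/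
def wordMap (Ψ : SimilitudeSystem n N) :
    List (Fin N) → EuclideanSpace ℝ (Fin n) → EuclideanSpace ℝ (Fin n)
  | [] => id
  | i :: w => Ψ.map i ∘ wordMap Ψ w

/-- `r_w = r_{w₁} ⋯ r_{w_k}` for a word `w = w₁ ⋯ w_k`. -/
def wordRatio (Ψ : SimilitudeSystem n N) (w : List (Fin N)) : ℝ := (w.map Ψ.ratio).prod

/-- The curtailment `i₁ ⋯ i_k` of an infinite code `i`. -/
def curtail (i : ℕ → Fin N) (k : ℕ) : List (Fin N) := (List.range k).map i

/-- The projection `π` of the code space: the limit of `f_{i₁} ∘ ⋯ ∘ f_{i_k} (0)`, which is the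
only point of `⋂ k, f_{i₁} ∘ ⋯ ∘ f_{i_k} (E)`. -/
def coding (Ψ : SimilitudeSystem n N) (i : ℕ → Fin N) : EuclideanSpace ℝ (Fin n) :=
  limUnder atTop (fun k => Ψ.wordMap (curtail i k) 0)

/-- The measure on `{1, …, N}` with weights `r_i ^ s`. -/
def weights (Ψ : SimilitudeSystem n N) (s : ℝ) : Measure (Fin N) :=
  Measure.sum fun i => ENNReal.ofReal (Ψ.ratio i ^ s) • Measure.dirac i

/-- The natural self-similar measure, where `∑ r_i ^ s = 1`: the image under the projection of the
Bernoulli measure with weights `r_i ^ s` on the code space. Under strong separation it is the Borel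
probability measure giving mass `r_w ^ s` to the cylinder `f_w(E)`: see
`naturalMeasure_cylinder`. -/
def naturalMeasure (Ψ : SimilitudeSystem n N) (s : ℝ) : Measure (EuclideanSpace ℝ (Fin n)) :=
  (Measure.infinitePi fun _ : ℕ => Ψ.weights s).map Ψ.coding

/-- `h(x,d) = (2d)^s / μ(B(x,d))`, with `B(x,d)` the closed ball and `μ` the natural measure. -/
def density (Ψ : SimilitudeSystem n N) (s : ℝ) (x : EuclideanSpace ℝ (Fin n)) (d : ℝ) : ℝ≥0∞ :=
  ENNReal.ofReal (2 * d) ^ s / Ψ.naturalMeasure s (Metric.closedBall x d)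

section facts

variable {Ψ : SimilitudeSystem n N} {E : Set (EuclideanSpace ℝ (Fin n))} {s : ℝ}

lemma dist_wordMap (Ψ : SimilitudeSystem n N) (w : List (Fin N)) (x y) :
    dist (Ψ.wordMap w x) (Ψ.wordMap w y) = Ψ.wordRatio w * dist x y := by
  induction w with
  | nil => simp [wordMap, wordRatio]
  | cons i w ih =>
    simp only [wordMap, Function.comp_apply, Ψ.dist_map, ih]
    simp [wordRatio, mul_assoc]

lemma wordMap_append (Ψ : SimilitudeSystem n N) (w v : List (Fin N)) :
    Ψ.wordMap (w ++ v) = Ψ.wordMap w ∘ Ψ.wordMap v := by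
  induction w with
  | nil => rfl
  | cons i w ih => simp [wordMap, ih, Function.comp_assoc]

lemma map_injective (Ψ : SimilitudeSystem n N) (i : Fin N) : Function.Injective (Ψ.map i) := by
  intro x y h
  have := Ψ.dist_map i x y
  rw [h, dist_self] at this
  exact dist_eq_zero.1 ((mul_eq_zero.1 this.symm).resolve_left (Ψ.ratio_pos i).ne')

lemma continuous_wordMap (Ψ : SimilitudeSystem n N) (w : List (Fin N)) :
    Continuous (Ψ.wordMap w) :=
  (LipschitzWith.of_dist_le' fun x y => (Ψ.dist_wordMap w x y).le).continuous

lemma IsAttractor.wordMap_subset (hE : Ψ.IsAttractor E) (w : List (Fin N)) :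
    Ψ.wordMap w '' E ⊆ E := by
  induction w with
  | nil => simp [wordMap]
  | cons i w ih =>
    rw [wordMap, image_comp]
    refine (image_mono ih).trans ?_
    conv_rhs => rw [hE.eq_iUnion]
    exact subset_iUnion (fun i => Ψ.map i '' E) i

lemma IsAttractor.isClosed_cylinder (hE : Ψ.IsAttractor E) (w : List (Fin N)) :
    IsClosed (Ψ.wordMap w '' E) :=
  (hE.isCompact.image (Ψ.continuous_wordMap w)).isClosed

lemma curtail_succ (i : ℕ → Fin N) (k : ℕ) : curtail i (k + 1) = curtail i k ++ [i k] := by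
  simp [curtail, List.range_succ]

lemma wordRatio_le (Ψ : SimilitudeSystem n N) :
    ∃ ρ : ℝ, 0 ≤ ρ ∧ ρ < 1 ∧ ∀ w : List (Fin N), Ψ.wordRatio w ≤ ρ ^ w.length := by
  obtain ⟨ρ, h0, h1, h⟩ : ∃ ρ : ℝ, 0 ≤ ρ ∧ ρ < 1 ∧ ∀ i, Ψ.ratio i ≤ ρ := by
    rcases isEmpty_or_nonempty (Fin N) with hN | hN
    · exact ⟨0, le_rfl, one_pos, fun i => isEmptyElim i⟩
    · obtain ⟨j, hj⟩ := Finite.exists_max Ψ.ratio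
      exact ⟨Ψ.ratio j, (Ψ.ratio_pos j).le, Ψ.ratio_lt_one j, hj⟩
  refine ⟨ρ, h0, h1, fun w => ?_⟩
  induction w with
  | nil => simp [wordRatio]
  | cons i w ih =>
    have hw : 0 ≤ Ψ.wordRatio w :=
      List.prod_nonneg fun x hx => by
        obtain ⟨i, -, rfl⟩ := List.mem_map.1 hx
        exact (Ψ.ratio_pos i).le
    have : Ψ.wordRatio (i :: w) = Ψ.ratio i * Ψ.wordRatio w := by simp [wordRatio]
    rw [this, List.length_cons, pow_succ']
    exact mul_le_mul (h i) ih hw h0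

lemma tendsto_coding (Ψ : SimilitudeSystem n N) (i : ℕ → Fin N) :
    Tendsto (fun k => Ψ.wordMap (curtail i k) 0) atTop (𝓝 (Ψ.coding i)) := by
  obtain ⟨ρ, h0, h1, hρ⟩ := Ψ.wordRatio_le
  obtain ⟨C, hC⟩ : ∃ C : ℝ, ∀ j : Fin N, dist (0 : EuclideanSpace ℝ (Fin n)) (Ψ.map j 0) ≤ C := by
    obtain ⟨C, hC⟩ := (finite_range fun j : Fin N =>
      dist (0 : EuclideanSpace ℝ (Fin n)) (Ψ.map j 0)).bddAbove
    exact ⟨C, fun j => hC ⟨j, rfl⟩⟩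
  have : CauchySeq fun k => Ψ.wordMap (curtail i k) 0 := by
    refine cauchySeq_of_le_geometric ρ C h1 fun k => ?_
    rw [curtail_succ, wordMap_append, Function.comp_apply, dist_wordMap, mul_comm]
    have h2 := hρ (curtail i k)
    rw [show (curtail i k).length = k by simp [curtail]] at h2
    exact mul_le_mul (hC (i k)) h2
      (List.prod_nonneg fun x hx => by
        obtain ⟨i, -, rfl⟩ := List.mem_map.1 hx
        exact (Ψ.ratio_pos i).le) (dist_nonneg.trans (hC (i k)))
  exact tendsto_nhds_limUnder (cauchySeq_tendsto_of_complete this)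

lemma IsAttractor.coding_mem (hE : Ψ.IsAttractor E) (i : ℕ → Fin N) (k : ℕ) :
    Ψ.coding i ∈ Ψ.wordMap (curtail i k) '' E := by
  obtain ⟨ρ, h0, h1, hρ⟩ := Ψ.wordRatio_le
  obtain ⟨e, he⟩ := hE.nonempty
  have ht : Tendsto (fun k => Ψ.wordMap (curtail i k) e) atTop (𝓝 (Ψ.coding i)) := by
    refine tendsto_of_tendsto_of_dist (Ψ.tendsto_coding i) ?_
    have hz : Tendsto (fun k : ℕ => ρ ^ k * dist (0 : EuclideanSpace ℝ (Fin n)) e) atTop (𝓝 0) := by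
      simpa using (tendsto_pow_atTop_nhds_zero_of_lt_one h0 h1).mul_const
        (dist (0 : EuclideanSpace ℝ (Fin n)) e)
    refine squeeze_zero (fun _ => dist_nonneg) (fun k => ?_) hz
    rw [dist_wordMap]
    have h2 := hρ (curtail i k)
    rw [show (curtail i k).length = k by simp [curtail]] at h2
    exact mul_le_mul_of_nonneg_right h2 dist_nonneg
  refine (hE.isClosed_cylinder _).mem_of_tendsto ht (eventually_atTop.2 ⟨k, fun m hm => ?_⟩)
  obtain ⟨l, rfl⟩ := Nat.exists_eq_add_of_le hm
  have : curtail i (k + l) = curtail i k ++ ((List.range l).map fun j => i (k + j)) := by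
    simp [curtail, List.range_add, Function.comp_def]
  rw [this, wordMap_append]
  exact mem_image_of_mem _ (hE.wordMap_subset _ (mem_image_of_mem _ he))

lemma measurable_coding (Ψ : SimilitudeSystem n N) : Measurable Ψ.coding := by
  refine measurable_of_tendsto_metrizable (f := fun k i => Ψ.wordMap (curtail i k) 0)
    (fun k => ?_) (tendsto_pi_nhds.2 Ψ.tendsto_coding)
  have h : (fun i : ℕ → Fin N => Ψ.wordMap (curtail i k) 0) =
      (fun u : Fin k → Fin N => Ψ.wordMap (List.ofFn u) 0) ∘ fun i j => i j := by
    funext i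
    simp only [Function.comp_apply]
    congr 1
    simp [curtail, List.ofFn_eq_map, ← List.map_coe_finRange_eq_range, Function.comp_def]
  rw [h]
  exact (measurable_of_finite _).comp (measurable_pi_lambda _ fun j => measurable_pi_apply _)

lemma StrongSeparation.eq_of_mem (hE : Ψ.IsAttractor E) (hS : Ψ.StrongSeparation E)
    {x : EuclideanSpace ℝ (Fin n)} {w v : List (Fin N)} (hl : w.length = v.length)
    (hw : x ∈ Ψ.wordMap w '' E) (hv : x ∈ Ψ.wordMap v '' E) : w = v := by
  induction w generalizing x v with
  | nil => exact (List.length_eq_zero_iff.1 hl.symm).symm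
  | cons a w ih =>
    cases v with
    | nil => simp at hl
    | cons b v =>
      rw [wordMap, image_comp] at hw hv
      obtain ⟨y, hy, rfl⟩ := hw
      obtain ⟨z, hz, hyz⟩ := hv
      have hab : a = b := by
        by_contra hab
        refine disjoint_left.1 (hS a b hab) (mem_image_of_mem _ (hE.wordMap_subset _ hy)) ?_
        rw [← hyz]
        exact mem_image_of_mem _ (hE.wordMap_subset _ hz)
      subst hab
      have := Ψ.map_injective a hyz
      subst this
      rw [ih (by simpa using hl) hy hz]

lemma weights_singleton (Ψ : SimilitudeSystem n N) (s : ℝ) (i : Fin N) :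
    Ψ.weights s {i} = ENNReal.ofReal (Ψ.ratio i ^ s) := by
  rw [weights, Measure.sum_apply _ (measurableSet_singleton i), tsum_fintype,
    Finset.sum_eq_single i]
  · simp
  · intro j _ hj
    simp [hj]
  · simp

lemma isProbabilityMeasure_weights (hs : ∑ i, Ψ.ratio i ^ s = 1) :
    IsProbabilityMeasure (Ψ.weights s) := by
  constructor
  rw [weights, Measure.sum_apply _ MeasurableSet.univ, tsum_fintype]
  simp only [Measure.smul_apply, measure_univ, smul_eq_mul, mul_one]
  rw [← ENNReal.ofReal_sum_of_nonneg fun i _ => Real.rpow_nonneg (Ψ.ratio_pos i).le s, hs,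
    ENNReal.ofReal_one]

/-- The natural measure gives mass `r_w ^ s` to the cylinder `f_w(E)`; for the empty word this
says that it is a probability measure carried by `E`. -/
theorem naturalMeasure_cylinder (hE : Ψ.IsAttractor E) (hS : Ψ.StrongSeparation E)
    (hs : ∑ i, Ψ.ratio i ^ s = 1) (w : List (Fin N)) :
    Ψ.naturalMeasure s (Ψ.wordMap w '' E) = ENNReal.ofReal (Ψ.wordRatio w ^ s) := by
  have := isProbabilityMeasure_weights hs
  rw [naturalMeasure, Measure.map_apply Ψ.measurable_coding (hE.isClosed_cylinder w).measurableSet]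
  have hpre : Ψ.coding ⁻¹' (Ψ.wordMap w '' E) =
      Set.pi (Finset.range w.length : Finset ℕ) fun j => {a | w[j]? = some a} := by
    ext i
    have h1 : Ψ.coding i ∈ Ψ.wordMap w '' E ↔ curtail i w.length = w := by
      constructor
      · intro h
        exact hS.eq_of_mem hE (by simp [curtail]) (hE.coding_mem i w.length) h
      · intro h
        have := hE.coding_mem i w.length
        rwa [h] at this
    rw [mem_preimage, h1, Set.mem_pi]
    constructor
    · intro h j hj
      have hj' : j < w.length := by simpa using hj
      conv_lhs => rw [← h]
      simp [curtail, hj']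
    · intro h
      refine List.ext_getElem? fun j => ?_
      by_cases hj : j < w.length
      · have := h j (by simpa using hj)
        rw [mem_ofPred_eq] at this
        rw [this]
        simp [curtail, hj]
      · rw [List.getElem?_eq_none (by simp [curtail]; omega), List.getElem?_eq_none (by omega)]
  rw [hpre, Measure.infinitePi_pi _ fun j _ => MeasurableSet.of_discrete]
  have hset : ∀ j : Fin w.length, {a | w[(j : ℕ)]? = some a} = {w[j]} := by
    intro j
    ext a
    simp [eq_comm]
  rw [← Fin.prod_univ_eq_prod_range
    (fun j => Ψ.weights s {a | w[j]? = some a}) w.length]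
  simp only [hset, weights_singleton]
  rw [← ENNReal.ofReal_prod_of_nonneg fun j _ => Real.rpow_nonneg (Ψ.ratio_pos _).le s,
    Real.finsetProd_rpow _ _ fun j _ => (Ψ.ratio_pos _).le]
  congr 2
  rw [wordRatio, ← List.prod_ofFn]
  congr 1
  exact List.ext_getElem (by simp) (by simp)

end facts

end SimilitudeSystem

section packing

variable {n : ℕ}

/-- `T` is a `δ`-packing of `A`: a countable collection of pairwise disjoint closed Euclidean balls
(given by their centres and radii), centred at points of `A` and of diameter at most `δ`. -/
structure IsPacking (δ : ℝ) (A : Set (EuclideanSpace ℝ (Fin n)))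
    (T : Set (EuclideanSpace ℝ (Fin n) × ℝ)) : Prop where
  countable : T.Countable
  center_mem : ∀ b ∈ T, b.1 ∈ A
  radius_pos : ∀ b ∈ T, 0 < b.2
  diam_le : ∀ b ∈ T, Metric.diam (Metric.closedBall b.1 b.2) ≤ δ
  disjoint : T.PairwiseDisjoint fun b => Metric.closedBall b.1 b.2

/-- `P^s_δ(A)`, the supremum over the `δ`-packings of `A` of the sum of `|B|^s`. -/
def packingDelta (s δ : ℝ) (A : Set (EuclideanSpace ℝ (Fin n))) : ℝ≥0∞ :=
  ⨆ (T : Set (EuclideanSpace ℝ (Fin n) × ℝ)) (_ : IsPacking δ A T),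
    ∑' b : T, ENNReal.ofReal (Metric.diam (Metric.closedBall b.1.1 b.1.2)) ^ s

/-- The packing premeasure `P^s_0(A) = lim_{δ → 0} P^s_δ(A)`; as `P^s_δ(A)` is nondecreasing in
`δ`, the limit is the infimum over `δ > 0`. -/
def packingPremeasure (s : ℝ) (A : Set (EuclideanSpace ℝ (Fin n))) : ℝ≥0∞ :=
  ⨅ (δ : ℝ) (_ : 0 < δ), packingDelta s δ A

/-- The packing measure `P^s(A) = inf {∑ P^s_0(U_i) : A ⊆ ⋃ U_i}`. -/
def packingMeasure (s : ℝ) (A : Set (EuclideanSpace ℝ (Fin n))) : ℝ≥0∞ :=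
  ⨅ (U : ℕ → Set (EuclideanSpace ℝ (Fin n))) (_ : A ⊆ ⋃ i, U i), ∑' i, packingPremeasure s (U i)

end packing

end

/-! Write `μ` for the natural measure and `h` for the density.

*Scaling.* The measure satisfies `μ = ∑ r_i ^ s • (f_i)_* μ` (`naturalMeasure_eq_sum`), so that
`h(f_w y, r_w d) ≤ h(y, d)`, with equality as soon as the ball `B(f_w y, r_w d)` meets `E` only in
`f_w(E)`. The inequality moves any ball of radius at most `a` to one with radius in
`[a r_min, a]` without decreasing `h`, so both suprema agree (`exists_density_le`). If the last
letter of `w` has the smallest ratio, equality holds for all `d < c / r_min`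
(`density_wordMap_eq`), which is where the bound on `a` enters.

*Upper bound.* The balls of a packing of `E` are disjoint and `(2d) ^ s = h(x, d) μ(B(x, d))`, so a
bound for `h` on `E × (0, a]` bounds the packing premeasure of `E` (`packingMeasure_le`).

*Lower bound.* Every finite word occurs infinitely often in the code of almost every point
(`ae_forall_exists_word`), so almost every point is the centre of arbitrarily small balls whose
density is at least nearly `h(x, d)`. By the Besicovitch covering theorem any set `U` is filled, up
to a null set, by disjoint balls of this kind centred in it; hence the packing premeasure of `U` is
at least `h(x, d) μ(U)`, and summing over a countable cover of `E` gives `h(x, d)` as a lower bound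
for the packing measure (`density_le_packingMeasure`).

*Attainment.* The density is continuous on `E × (0, ∞)` because spheres centred in `E` are null
(`naturalMeasure_sphere`). Indeed a sphere of positive measure fills small cylinders almost
entirely; blown up to unit size, it flattens to a hyperplane that contains `E`. Its normal vector
can be kept in the direction of the affine span of `E`, because the centre lies in `E`, and this is
absurd. The maximum over the compact set `E × [a r_min, a]` is therefore attained.
-/

/-! ### Words and cylinders -/

namespace SimilitudeSystem

variable {n N : ℕ} {Ψ : SimilitudeSystem n N} {E : Set (EuclideanSpace ℝ (Fin n))} {s : ℝ}

lemma wordRatio_cons (Ψ : SimilitudeSystem n N) (i : Fin N) (w : List (Fin N)) :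
    Ψ.wordRatio (i :: w) = Ψ.ratio i * Ψ.wordRatio w := by
  simp [wordRatio]

lemma wordRatio_append (Ψ : SimilitudeSystem n N) (w v : List (Fin N)) :
    Ψ.wordRatio (w ++ v) = Ψ.wordRatio w * Ψ.wordRatio v := by
  simp [wordRatio]

lemma wordRatio_singleton (Ψ : SimilitudeSystem n N) (i : Fin N) :
    Ψ.wordRatio [i] = Ψ.ratio i := by
  simp [wordRatio]

lemma wordRatio_pos (Ψ : SimilitudeSystem n N) (w : List (Fin N)) : 0 < Ψ.wordRatio w := by
  induction w with
  | nil => simp [wordRatio]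
  | cons i w ih => rw [wordRatio_cons]; exact mul_pos (Ψ.ratio_pos i) ih

lemma wordRatio_le_one (Ψ : SimilitudeSystem n N) (w : List (Fin N)) : Ψ.wordRatio w ≤ 1 := by
  obtain ⟨ρ, h0, h1, hρ⟩ := Ψ.wordRatio_le
  exact (hρ w).trans (pow_le_one₀ h0 h1.le)

lemma wordMap_preimage_closedBall (Ψ : SimilitudeSystem n N) (w : List (Fin N))
    (y : EuclideanSpace ℝ (Fin n)) (d : ℝ) :
    Ψ.wordMap w ⁻¹' Metric.closedBall (Ψ.wordMap w y) (Ψ.wordRatio w * d) =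
      Metric.closedBall y d := by
  ext z
  rw [mem_preimage, Metric.mem_closedBall, Metric.mem_closedBall, dist_wordMap]
  exact mul_le_mul_iff_right₀ (Ψ.wordRatio_pos w)

lemma continuous_map (Ψ : SimilitudeSystem n N) (i : Fin N) : Continuous (Ψ.map i) :=
  Ψ.continuous_wordMap [i]

lemma IsAttractor.map_mem (hE : Ψ.IsAttractor E) (i : Fin N) {x : EuclideanSpace ℝ (Fin n)}
    (hx : x ∈ E) : Ψ.map i x ∈ E :=
  hE.wordMap_subset [i] (mem_image_of_mem _ hx)

lemma IsAttractor.wordMap_mem (hE : Ψ.IsAttractor E) (w : List (Fin N))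
    {x : EuclideanSpace ℝ (Fin n)} (hx : x ∈ E) : Ψ.wordMap w x ∈ E :=
  hE.wordMap_subset w (mem_image_of_mem _ hx)

lemma IsAttractor.exists_map_eq (hE : Ψ.IsAttractor E) {x : EuclideanSpace ℝ (Fin n)}
    (hx : x ∈ E) : ∃ i, ∃ y ∈ E, Ψ.map i y = x := by
  rw [hE.eq_iUnion] at hx
  simpa using hx

lemma IsAttractor.exists_word (hE : Ψ.IsAttractor E) (k : ℕ) {x : EuclideanSpace ℝ (Fin n)}
    (hx : x ∈ E) : ∃ w : List (Fin N), w.length = k ∧ x ∈ Ψ.wordMap w '' E := by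
  induction k generalizing x with
  | zero => exact ⟨[], rfl, x, hx, rfl⟩
  | succ k ih =>
    obtain ⟨i, y, hy, rfl⟩ := hE.exists_map_eq hx
    obtain ⟨w, hw, z, hz, rfl⟩ := ih hy
    exact ⟨i :: w, by simp [hw], z, hz, rfl⟩

/-- The diameters of cylinders tend to zero with their level, uniformly in the word. -/
lemma IsAttractor.exists_tendsto_diam (hE : Ψ.IsAttractor E) :
    ∃ η : ℕ → ℝ, Tendsto η atTop (𝓝 0) ∧ ∀ w : List (Fin N), ∀ x ∈ Ψ.wordMap w '' E,
      ∀ y ∈ Ψ.wordMap w '' E, dist x y ≤ η w.length := by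
  obtain ⟨ρ, h0, h1, hρ⟩ := Ψ.wordRatio_le
  refine ⟨fun k => ρ ^ k * Metric.diam E, ?_, ?_⟩
  · simpa using (tendsto_pow_atTop_nhds_zero_of_lt_one h0 h1).mul_const (Metric.diam E)
  · rintro w _ ⟨x, hx, rfl⟩ _ ⟨y, hy, rfl⟩
    rw [dist_wordMap]
    exact mul_le_mul (hρ w) (Metric.dist_le_diam_of_mem hE.isCompact.isBounded hx hy)
      dist_nonneg (pow_nonneg h0 _)

/-- A small cylinder around a given point of the attractor. -/
lemma IsAttractor.exists_word_subset_closedBall (hE : Ψ.IsAttractor E)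
    {x : EuclideanSpace ℝ (Fin n)} (hx : x ∈ E) {ε : ℝ} (hε : 0 < ε) :
    ∃ w : List (Fin N), Ψ.wordMap w '' E ⊆ Metric.closedBall x ε := by
  obtain ⟨η, hη, h⟩ := hE.exists_tendsto_diam
  obtain ⟨k, hk⟩ := (hη.eventually_le_const hε).exists
  obtain ⟨w, hw, hxw⟩ := hE.exists_word k hx
  exact ⟨w, fun y hy => (h w y hy x hxw).trans (by rwa [hw])⟩

lemma ratioMin_le (Ψ : SimilitudeSystem n N) (i : Fin N) : Ψ.ratioMin ≤ Ψ.ratio i :=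
  ciInf_le (finite_range _).bddBelow i

lemma gap_le_dist (Ψ : SimilitudeSystem n N) {i j : Fin N} (hij : i ≠ j)
    {x y : EuclideanSpace ℝ (Fin n)} (hx : x ∈ Ψ.map i '' E) (hy : y ∈ Ψ.map j '' E) :
    Ψ.gap E ≤ dist x y := by
  refine (ciInf_le (finite_range _).bddBelow
    (⟨(i, j), hij⟩ : {p : Fin N × Fin N // p.1 ≠ p.2})).trans ?_
  exact ciInf_le (f := fun p : (Ψ.map i '' E) × (Ψ.map j '' E) =>
    dist (p.1 : EuclideanSpace ℝ (Fin n)) (p.2 : EuclideanSpace ℝ (Fin n)))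
    ⟨0, by rintro _ ⟨p, rfl⟩; exact dist_nonneg⟩ (⟨x, hx⟩, ⟨y, hy⟩)

/-- The cylinder of `v ++ [i]` is separated from the rest of the attractor by `r_v * c`. -/
lemma IsAttractor.mem_cylinder_of_dist_lt (hE : Ψ.IsAttractor E) (v : List (Fin N)) (i : Fin N)
    {y z : EuclideanSpace ℝ (Fin n)} (hy : y ∈ E) (hz : z ∈ E)
    (h : dist (Ψ.wordMap (v ++ [i]) y) z < Ψ.wordRatio v * Ψ.gap E) :
    z ∈ Ψ.wordMap (v ++ [i]) '' E := by
  induction v generalizing z with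
  | nil =>
    obtain ⟨j, u, hu, rfl⟩ := hE.exists_map_eq hz
    rcases eq_or_ne i j with rfl | hij
    · exact ⟨u, hu, rfl⟩
    · have := Ψ.gap_le_dist hij (mem_image_of_mem _ hy) (mem_image_of_mem _ hu)
      simp [wordMap, wordRatio] at h
      linarith
  | cons l v ih =>
    obtain ⟨j, u, hu, rfl⟩ := hE.exists_map_eq hz
    have hr := Ψ.ratio_pos l
    rcases eq_or_ne l j with rfl | hij
    · rw [List.cons_append, wordMap, Function.comp_apply, Ψ.dist_map, wordRatio_cons,
        mul_assoc] at h
      obtain ⟨t, ht, rfl⟩ := ih hu ((mul_lt_mul_iff_right₀ hr).1 h)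
      exact ⟨t, ht, rfl⟩
    · have h1 := Ψ.gap_le_dist hij (mem_image_of_mem _ (hE.wordMap_mem (v ++ [i]) hy))
        (mem_image_of_mem _ hu)
      have h2 : Ψ.wordRatio (l :: v) * Ψ.gap E ≤ Ψ.gap E :=
        mul_le_of_le_one_left
          (Real.iInf_nonneg fun _ => Real.iInf_nonneg fun _ => dist_nonneg)
          (Ψ.wordRatio_le_one _)
      exact absurd (h.trans_le h2) (not_lt.2 h1)

/-! ### Comparison of measures through cylinders -/

/-- Inequality between the masses of all sufficiently deep cylinders passes to closed subsets of
the attractor, since such a set is the intersection of its decreasing covers by cylinders. -/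
lemma StrongSeparation.measure_inter_le (hE : Ψ.IsAttractor E) (hS : Ψ.StrongSeparation E)
    {μ ν : Measure (EuclideanSpace ℝ (Fin n))} [IsFiniteMeasure ν] (m : ℕ)
    (h : ∀ w : List (Fin N), m ≤ w.length → μ (Ψ.wordMap w '' E) ≤ ν (Ψ.wordMap w '' E))
    {K : Set (EuclideanSpace ℝ (Fin n))} (hK : IsClosed K) : μ (K ∩ E) ≤ ν (K ∩ E) := by
  obtain ⟨η, hη, hηE⟩ := hE.exists_tendsto_diam
  have hlim : Tendsto (fun k => ν (Metric.cthickening (η k) (K ∩ E))) atTop (𝓝 (ν (K ∩ E))) :=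
    (tendsto_measure_cthickening_of_isClosed ⟨1, one_pos, measure_ne_top _ _⟩
      (hK.inter hE.isCompact.isClosed)).comp hη
  refine ge_of_tendsto hlim (eventually_atTop.2 ⟨m, fun k hk => ?_⟩)
  set W : Set (List (Fin N)) := {w | w.length = k ∧ (K ∩ Ψ.wordMap w '' E).Nonempty} with hW
  have hWc : W.Countable := ((List.finite_length_eq (Fin N) k).subset fun w hw => hw.1).countable
  have hcover : K ∩ E ⊆ ⋃ w ∈ W, Ψ.wordMap w '' E := by
    rintro x ⟨hxK, hxE⟩
    obtain ⟨w, hw, hxw⟩ := hE.exists_word k hxE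
    exact mem_biUnion (show w ∈ W from ⟨hw, x, hxK, hxw⟩) hxw
  have hdisj : W.PairwiseDisjoint fun w => Ψ.wordMap w '' E := by
    intro w hw v hv hwv
    rw [Function.onFun, disjoint_left]
    exact fun x hx hx' => hwv (hS.eq_of_mem hE (hw.1.trans hv.1.symm) hx hx')
  calc μ (K ∩ E) ≤ μ (⋃ w ∈ W, Ψ.wordMap w '' E) := measure_mono hcover
    _ ≤ ∑' w : W, μ (Ψ.wordMap w '' E) := measure_biUnion_le μ hWc _
    _ ≤ ∑' w : W, ν (Ψ.wordMap w '' E) :=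
        ENNReal.tsum_le_tsum fun w => h w (hk.trans_eq w.2.1.symm)
    _ = ν (⋃ w ∈ W, Ψ.wordMap w '' E) :=
        (measure_biUnion hWc hdisj fun w _ => (hE.isClosed_cylinder w).measurableSet).symm
    _ ≤ ν (Metric.cthickening (η k) (K ∩ E)) := by
        refine measure_mono (iUnion₂_subset ?_)
        rintro w ⟨rfl, y, hyK, hyw⟩ x hx
        exact Metric.mem_cthickening_of_dist_le x y _ _ ⟨hyK, hE.wordMap_subset w hyw⟩
          (hηE w x hx y hyw)

/-! ### Self-similarity of the natural measure -/

/-- The mass `r_w ^ s` of the cylinder `f_w(E)`. -/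
noncomputable def wordWeight (Ψ : SimilitudeSystem n N) (s : ℝ) (w : List (Fin N)) : ℝ≥0∞ :=
  ENNReal.ofReal (Ψ.wordRatio w ^ s)

lemma wordWeight_ne_zero (Ψ : SimilitudeSystem n N) (s : ℝ) (w : List (Fin N)) :
    Ψ.wordWeight s w ≠ 0 := by
  simpa [wordWeight] using Real.rpow_pos_of_pos (Ψ.wordRatio_pos w) s

lemma wordWeight_ne_top (Ψ : SimilitudeSystem n N) (s : ℝ) (w : List (Fin N)) :
    Ψ.wordWeight s w ≠ ∞ := ENNReal.ofReal_ne_top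

lemma wordWeight_append (Ψ : SimilitudeSystem n N) (s : ℝ) (w v : List (Fin N)) :
    Ψ.wordWeight s (w ++ v) = Ψ.wordWeight s w * Ψ.wordWeight s v := by
  rw [wordWeight, wordRatio_append, Real.mul_rpow (Ψ.wordRatio_pos w).le (Ψ.wordRatio_pos v).le,
    ENNReal.ofReal_mul (Real.rpow_nonneg (Ψ.wordRatio_pos w).le s)]
  rfl

lemma wordWeight_cons (Ψ : SimilitudeSystem n N) (s : ℝ) (i : Fin N) (w : List (Fin N)) :
    Ψ.wordWeight s (i :: w) = Ψ.wordWeight s [i] * Ψ.wordWeight s w :=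
  Ψ.wordWeight_append s [i] w

lemma sum_wordWeight (hs : ∑ i, Ψ.ratio i ^ s = 1) : ∑ i, Ψ.wordWeight s [i] = 1 := by
  simp only [wordWeight, wordRatio_singleton]
  rw [← ENNReal.ofReal_sum_of_nonneg fun i _ => Real.rpow_nonneg (Ψ.ratio_pos i).le s, hs,
    ENNReal.ofReal_one]

lemma isProbabilityMeasure_naturalMeasure (hs : ∑ i, Ψ.ratio i ^ s = 1) :
    IsProbabilityMeasure (Ψ.naturalMeasure s) := by
  have := isProbabilityMeasure_weights hs
  exact Measure.isProbabilityMeasure_map Ψ.measurable_coding.aemeasurable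

lemma IsAttractor.ae_mem (hE : Ψ.IsAttractor E) (s : ℝ) : ∀ᵐ x ∂Ψ.naturalMeasure s, x ∈ E := by
  refine (ae_map_iff (p := fun x => x ∈ E) Ψ.measurable_coding.aemeasurable
    hE.isCompact.measurableSet).2 (ae_of_all _ fun i => ?_)
  simpa [curtail, wordMap] using hE.coding_mem i 0

lemma naturalMeasure_eq_zero (hE : Ψ.IsAttractor E) {A : Set (EuclideanSpace ℝ (Fin n))}
    (hA : Disjoint A E) : Ψ.naturalMeasure s A = 0 :=
  measure_mono_null (fun _ hx => disjoint_left.1 hA hx) (hE.ae_mem s)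

lemma naturalMeasure_inter (hE : Ψ.IsAttractor E) (A : Set (EuclideanSpace ℝ (Fin n))) :
    Ψ.naturalMeasure s (A ∩ E) = Ψ.naturalMeasure s A := by
  refine measure_congr ?_
  filter_upwards [hE.ae_mem s] with x hx
  exact propext ⟨fun h => h.1, fun h => ⟨h, hx⟩⟩

/-- `μ = ∑ r_i ^ s • (f_i)_* μ`. -/
lemma naturalMeasure_eq_sum (hE : Ψ.IsAttractor E) (hS : Ψ.StrongSeparation E)
    (hs : ∑ i, Ψ.ratio i ^ s = 1) {A : Set (EuclideanSpace ℝ (Fin n))} (hA : MeasurableSet A) :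
    Ψ.naturalMeasure s A = ∑ i, Ψ.wordWeight s [i] * Ψ.naturalMeasure s (Ψ.map i ⁻¹' A) := by
  have := isProbabilityMeasure_naturalMeasure hs
  set μ := Ψ.naturalMeasure s with hμ
  set ν : Measure (EuclideanSpace ℝ (Fin n)) := ∑ i, Ψ.wordWeight s [i] • μ.map (Ψ.map i) with hν
  have hνA : ∀ B, MeasurableSet B → ν B = ∑ i, Ψ.wordWeight s [i] * μ (Ψ.map i ⁻¹' B) := by
    intro B hB
    simp [hν, Measure.map_apply (Ψ.continuous_map _).measurable hB]
  rw [← hνA A hA]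
  have huniv : ν univ = 1 := by rw [hνA _ .univ]; simp [sum_wordWeight hs]
  have : IsFiniteMeasure ν := ⟨by simp [huniv]⟩
  have hμE : ∀ B, μ (B ∩ E) = μ B := naturalMeasure_inter hE
  have hνE : ∀ B, MeasurableSet B → ν (B ∩ E) = ν B := by
    intro B hB
    rw [hνA _ (hB.inter hE.isCompact.measurableSet), hνA _ hB]
    refine Finset.sum_congr rfl fun i _ => ?_
    rw [← hμE (_ ⁻¹' (B ∩ E)), ← hμE (_ ⁻¹' B)]
    congr 2
    ext x
    simp only [mem_inter_iff, mem_preimage]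
    exact ⟨fun h => ⟨h.1.1, h.2⟩, fun h => ⟨⟨h.1, hE.map_mem i h.2⟩, h.2⟩⟩
  have hcyl : ∀ w : List (Fin N), μ (Ψ.wordMap w '' E) = ν (Ψ.wordMap w '' E) := by
    intro w
    cases w with
    | nil =>
      have h1 := hνE univ .univ
      have h2 := hμE univ
      simp only [univ_inter, huniv, measure_univ] at h1 h2
      simp [wordMap, h1, h2]
    | cons j w =>
      rw [hνA _ (hE.isClosed_cylinder _).measurableSet, Finset.sum_eq_single j]
      · rw [wordMap, image_comp, preimage_image_eq _ (Ψ.map_injective j), ← image_comp,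
          show Ψ.map j ∘ Ψ.wordMap w = Ψ.wordMap (j :: w) from rfl, hμ,
          naturalMeasure_cylinder hE hS hs, naturalMeasure_cylinder hE hS hs]
        exact Ψ.wordWeight_cons s j w
      · intro i _ hij
        rw [hμ, naturalMeasure_eq_zero hE, mul_zero]
        rw [disjoint_left]
        rintro x ⟨y, hy, hyx⟩ hx
        exact disjoint_left.1 (hS i j hij) (mem_image_of_mem _ hx)
          ⟨Ψ.wordMap w y, hE.wordMap_mem w hy, hyx⟩
      · simp
  have hext : μ = ν := by
    refine ext_of_generate_finite _ (BorelSpace.measurable_eq.trans borel_eq_generateFrom_isClosed)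
      isPiSystem_isClosed (fun K hK => ?_) (by simp [huniv])
    rw [← hμE K, ← hνE K (IsClosed.measurableSet hK)]
    exact le_antisymm (hS.measure_inter_le hE 0 (fun w _ => (hcyl w).le) hK)
      (hS.measure_inter_le hE 0 (fun w _ => (hcyl w).ge) hK)
  exact DFunLike.congr_fun hext A

lemma wordWeight_mul_le (hE : Ψ.IsAttractor E) (hS : Ψ.StrongSeparation E)
    (hs : ∑ i, Ψ.ratio i ^ s = 1) (w : List (Fin N)) {A : Set (EuclideanSpace ℝ (Fin n))}
    (hA : MeasurableSet A) :
    Ψ.wordWeight s w * Ψ.naturalMeasure s (Ψ.wordMap w ⁻¹' A) ≤ Ψ.naturalMeasure s A := by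
  induction w generalizing A with
  | nil => simp [wordWeight, wordRatio, wordMap]
  | cons i w ih =>
    rw [wordWeight_cons, mul_assoc, naturalMeasure_eq_sum hE hS hs hA]
    refine (mul_le_mul_right (ih (hA.preimage (Ψ.continuous_map i).measurable)) _).trans ?_
    exact Finset.single_le_sum (f := fun i => Ψ.wordWeight s [i] *
      Ψ.naturalMeasure s (Ψ.map i ⁻¹' A)) (fun _ _ => zero_le) (Finset.mem_univ i)

lemma wordWeight_mul_eq (hE : Ψ.IsAttractor E) (hS : Ψ.StrongSeparation E)
    (hs : ∑ i, Ψ.ratio i ^ s = 1) (w : List (Fin N)) {A : Set (EuclideanSpace ℝ (Fin n))}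
    (hA : MeasurableSet A) (hAw : A ∩ E ⊆ Ψ.wordMap w '' E) :
    Ψ.wordWeight s w * Ψ.naturalMeasure s (Ψ.wordMap w ⁻¹' A) = Ψ.naturalMeasure s A := by
  induction w generalizing A with
  | nil => simp [wordWeight, wordRatio, wordMap]
  | cons i w ih =>
    rw [wordWeight_cons, mul_assoc, naturalMeasure_eq_sum hE hS hs hA, Finset.sum_eq_single i]
    · congr 1
      refine ih (hA.preimage (Ψ.continuous_map i).measurable) ?_
      rintro y ⟨hyA, hyE⟩
      obtain ⟨z, hz, hzy⟩ := hAw ⟨hyA, hE.map_mem i hyE⟩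
      exact ⟨z, hz, Ψ.map_injective i hzy⟩
    · intro j _ hji
      rw [naturalMeasure_eq_zero hE, mul_zero]
      rw [disjoint_left]
      intro y hyA hyE
      obtain ⟨z, hz, hzy⟩ := hAw ⟨hyA, hE.map_mem j hyE⟩
      exact disjoint_left.1 (hS j i hji) (mem_image_of_mem _ hyE)
        ⟨_, hE.wordMap_mem w hz, hzy⟩
    · simp

lemma naturalMeasure_closedBall_ne_zero (hE : Ψ.IsAttractor E) (hS : Ψ.StrongSeparation E)
    (hs : ∑ i, Ψ.ratio i ^ s = 1) {x : EuclideanSpace ℝ (Fin n)} (hx : x ∈ E) {d : ℝ}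
    (hd : 0 < d) : Ψ.naturalMeasure s (Metric.closedBall x d) ≠ 0 := by
  obtain ⟨w, hw⟩ := hE.exists_word_subset_closedBall hx hd
  intro h
  have h1 := measure_mono_null hw h
  rw [naturalMeasure_cylinder hE hS hs] at h1
  exact Ψ.wordWeight_ne_zero s w h1

/-! ### Scaling of the density -/

lemma density_eq_div (Ψ : SimilitudeSystem n N) (w : List (Fin N)) (y : EuclideanSpace ℝ (Fin n))
    {d : ℝ} (hd : 0 < d) :
    Ψ.density s y d = ENNReal.ofReal (2 * (Ψ.wordRatio w * d)) ^ s /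
      (Ψ.wordWeight s w * Ψ.naturalMeasure s (Metric.closedBall y d)) := by
  have hr := Ψ.wordRatio_pos w
  have h1 : ENNReal.ofReal (2 * (Ψ.wordRatio w * d)) ^ s =
      Ψ.wordWeight s w * ENNReal.ofReal (2 * d) ^ s := by
    rw [show 2 * (Ψ.wordRatio w * d) = Ψ.wordRatio w * (2 * d) by ring,
      ENNReal.ofReal_rpow_of_pos (by positivity), ENNReal.ofReal_rpow_of_pos (by positivity),
      Real.mul_rpow hr.le (by positivity), ENNReal.ofReal_mul (by positivity)]
    rfl
  rw [h1, ENNReal.mul_div_mul_left _ _ (Ψ.wordWeight_ne_zero s w) (Ψ.wordWeight_ne_top s w)]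
  rfl

lemma density_wordMap_le (hE : Ψ.IsAttractor E) (hS : Ψ.StrongSeparation E)
    (hs : ∑ i, Ψ.ratio i ^ s = 1) (w : List (Fin N)) (y : EuclideanSpace ℝ (Fin n))
    {d : ℝ} (hd : 0 < d) :
    Ψ.density s (Ψ.wordMap w y) (Ψ.wordRatio w * d) ≤ Ψ.density s y d := by
  rw [Ψ.density_eq_div w y hd, density]
  refine ENNReal.div_le_div_left ?_ _
  rw [← wordMap_preimage_closedBall Ψ w]
  exact wordWeight_mul_le hE hS hs w Metric.isClosed_closedBall.measurableSet

/-- The density is invariant under `f_w`, `w = v ++ [i]`, at radii so small that the image ball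
meets the attractor only in `f_w(E)`. -/
lemma density_wordMap_eq (hE : Ψ.IsAttractor E) (hS : Ψ.StrongSeparation E)
    (hs : ∑ i, Ψ.ratio i ^ s = 1) (v : List (Fin N)) (i : Fin N) {y : EuclideanSpace ℝ (Fin n)}
    (hy : y ∈ E) {d : ℝ} (hd : 0 < d) (hdi : Ψ.ratio i * d < Ψ.gap E) :
    Ψ.density s (Ψ.wordMap (v ++ [i]) y) (Ψ.wordRatio (v ++ [i]) * d) = Ψ.density s y d := by
  rw [Ψ.density_eq_div (v ++ [i]) y hd, density]
  suffices h : Ψ.naturalMeasure s (Metric.closedBall (Ψ.wordMap (v ++ [i]) y)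
      (Ψ.wordRatio (v ++ [i]) * d)) =
        Ψ.wordWeight s (v ++ [i]) * Ψ.naturalMeasure s (Metric.closedBall y d) by rw [h]
  rw [← wordMap_preimage_closedBall Ψ (v ++ [i]) y d]
  refine (wordWeight_mul_eq hE hS hs _ Metric.isClosed_closedBall.measurableSet ?_).symm
  rintro z ⟨hz, hzE⟩
  refine hE.mem_cylinder_of_dist_lt v i hy hzE ?_
  rw [Metric.mem_closedBall, dist_comm] at hz
  refine hz.trans_lt ?_
  rw [wordRatio_append, wordRatio_singleton, mul_assoc]
  exact (mul_lt_mul_iff_right₀ (Ψ.wordRatio_pos v)).2 hdi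

/-! ### Recurrence of words -/

/-- The points whose code does not have the word `v` after any prefix form a null set: the set
is invariant up to null sets under all `f_i ⁻¹`, while its preimage under `f_v` misses `E`. -/
lemma naturalMeasure_compl_iUnion_eq_zero (hE : Ψ.IsAttractor E) (hS : Ψ.StrongSeparation E)
    (hs : ∑ i, Ψ.ratio i ^ s = 1) (v : List (Fin N)) :
    Ψ.naturalMeasure s (⋃ w : List (Fin N), Ψ.wordMap (w ++ v) '' E)ᶜ = 0 := by
  have := isProbabilityMeasure_naturalMeasure hs
  set μ := Ψ.naturalMeasure s with hμ
  set A := (⋃ w : List (Fin N), Ψ.wordMap (w ++ v) '' E)ᶜ with hA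
  have hAm : MeasurableSet A :=
    (MeasurableSet.iUnion fun w => (hE.isClosed_cylinder _).measurableSet).compl
  have hsub : ∀ i, Ψ.map i ⁻¹' A ⊆ A := by
    intro i x hx hx'
    obtain ⟨w, y, hy, rfl⟩ := mem_iUnion.1 hx'
    exact hx (mem_iUnion.2 ⟨i :: w, y, hy, rfl⟩)
  have heq : ∀ i, μ (A \ Ψ.map i ⁻¹' A) = 0 := by
    intro i
    have hm : MeasurableSet (Ψ.map i ⁻¹' A) := hAm.preimage (Ψ.continuous_map i).measurable
    rw [measure_sdiff (hsub i) hm.nullMeasurableSet (measure_ne_top _ _)]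
    refine tsub_eq_zero_of_le ?_
    by_contra! hlt
    have hsum := naturalMeasure_eq_sum hE hS hs hAm
    rw [← hμ] at hsum
    refine absurd hsum (ne_of_gt ?_)
    calc ∑ i, Ψ.wordWeight s [i] * μ (Ψ.map i ⁻¹' A)
        < ∑ i, Ψ.wordWeight s [i] * μ A := by
          rw [← tsum_fintype (L := .unconditional _), ← tsum_fintype (L := .unconditional _)]
          refine ENNReal.tsum_lt_tsum (i := i) ?_
            (fun j => by gcongr; exact hsub j) ?_
          · rw [tsum_fintype, ← hsum]
            exact measure_ne_top _ _
          · exact ENNReal.mul_lt_mul_right (Ψ.wordWeight_ne_zero s [i]) (Ψ.wordWeight_ne_top s [i])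
              hlt
      _ = μ A := by rw [← Finset.sum_mul, sum_wordWeight hs, one_mul]
  have key : ∀ u : List (Fin N), μ A ≤ μ (Ψ.wordMap u ⁻¹' A) := by
    intro u
    induction u with
    | nil => exact le_rfl
    | cons i u ih =>
      have hnull : μ (Ψ.wordMap u ⁻¹' (A \ Ψ.map i ⁻¹' A)) = 0 := by
        have h := wordWeight_mul_le hE hS hs u
          (hAm.diff (hAm.preimage (Ψ.continuous_map i).measurable))
        rw [← hμ, heq i, nonpos_iff_eq_zero, mul_eq_zero] at h
        exact h.resolve_left (Ψ.wordWeight_ne_zero s u)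
      calc μ A ≤ μ (Ψ.wordMap u ⁻¹' A) := ih
        _ ≤ μ (Ψ.wordMap (i :: u) ⁻¹' A ∪ Ψ.wordMap u ⁻¹' (A \ Ψ.map i ⁻¹' A)) := by
          refine measure_mono fun x hx => ?_
          by_cases h : Ψ.wordMap u x ∈ Ψ.map i ⁻¹' A
          · exact Or.inl h
          · exact Or.inr ⟨hx, h⟩
        _ ≤ μ (Ψ.wordMap (i :: u) ⁻¹' A) := by
          refine (measure_union_le _ _).trans ?_
          rw [hnull, add_zero]
  refine le_antisymm ((key v).trans (naturalMeasure_eq_zero hE ?_).le) zero_le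
  rw [disjoint_left]
  exact fun x hx hxE => hx (mem_iUnion.2 ⟨[], x, hxE, rfl⟩)

/-- Almost every point has the word `v` in its code after arbitrarily long prefixes. -/
lemma ae_forall_exists_word (hE : Ψ.IsAttractor E) (hS : Ψ.StrongSeparation E)
    (hs : ∑ i, Ψ.ratio i ^ s = 1) (v : List (Fin N)) :
    ∀ᵐ z ∂Ψ.naturalMeasure s, ∀ k : ℕ, ∃ w : List (Fin N), k ≤ w.length ∧
      z ∈ Ψ.wordMap (w ++ v) '' E := by
  have := isProbabilityMeasure_naturalMeasure hs
  rw [ae_all_iff]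
  intro k
  set B : ℕ → Set (EuclideanSpace ℝ (Fin n)) := fun k =>
    (⋃ (w : List (Fin N)) (_ : k ≤ w.length), Ψ.wordMap (w ++ v) '' E)ᶜ with hB
  have hBm : ∀ k, MeasurableSet (B k) := fun k =>
    (MeasurableSet.iUnion fun w => .iUnion fun _ => (hE.isClosed_cylinder _).measurableSet).compl
  have hBk : Ψ.naturalMeasure s (B k) = 0 := by
    induction k with
    | zero => simpa [hB] using naturalMeasure_compl_iUnion_eq_zero hE hS hs v
    | succ k ih =>
      rw [naturalMeasure_eq_sum hE hS hs (hBm _)]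
      refine Finset.sum_eq_zero fun i _ => ?_
      rw [measure_mono_null ?_ ih, mul_zero]
      intro x hx hx'
      obtain ⟨w, hw, y, hy, rfl⟩ := mem_iUnion₂.1 hx'
      exact hx (mem_iUnion₂.2 ⟨i :: w, by simpa using hw, y, hy, rfl⟩)
  filter_upwards [compl_mem_ae_iff.2 hBk] with z hz
  simpa [hB] using hz

/-! ### The packing measure and the density -/

/-- In dimension zero all cylinders coincide. Positive dimension is needed for a closed ball of
radius `r` to have diameter `2 * r`. -/
lemma ne_zero_of_strongSeparation (hN : 2 ≤ N) (hE : Ψ.IsAttractor E)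
    (hS : Ψ.StrongSeparation E) : n ≠ 0 := by
  rintro rfl
  obtain ⟨x, hx⟩ := hE.nonempty
  have h01 : (⟨0, by omega⟩ : Fin N) ≠ ⟨1, by omega⟩ := by simp
  exact disjoint_left.1 (hS _ _ h01) (mem_image_of_mem _ hx)
    ⟨x, hx, Subsingleton.elim _ _⟩

/-- If the density is at least `H` at arbitrarily small radii almost everywhere, then the packing
premeasure dominates `H • μ`: the balls of density at least `H` are a Besicovitch cover, and
contain a disjoint family that fills almost all of the set. -/
lemma mul_naturalMeasure_le_packingPremeasure [NeZero n] (hE : Ψ.IsAttractor E)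
    (hS : Ψ.StrongSeparation E) (hs : ∑ i, Ψ.ratio i ^ s = 1) {H : ℝ≥0∞}
    (hH : ∀ᵐ z ∂Ψ.naturalMeasure s, ∀ δ > 0, ∃ d, 0 < d ∧ d < δ ∧ H ≤ Ψ.density s z d)
    (U : Set (EuclideanSpace ℝ (Fin n))) :
    H * Ψ.naturalMeasure s U ≤ packingPremeasure s U := by
  have := isProbabilityMeasure_naturalMeasure hs
  set μ := Ψ.naturalMeasure s with hμ
  refine le_iInf₂ fun δ hδ => ?_
  set G : Set (EuclideanSpace ℝ (Fin n)) :=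
    {z | z ∈ E ∧ ∀ δ > 0, ∃ d, 0 < d ∧ d < δ ∧ H ≤ Ψ.density s z d} with hG
  have hUG : μ (U ∩ G) = μ U := by
    refine measure_congr ?_
    filter_upwards [hE.ae_mem s, hH] with x hx hx'
    exact propext ⟨fun h => h.1, fun h => ⟨h, hx, hx'⟩⟩
  obtain ⟨t, r, htc, htU, htr, htμ, htd⟩ := Besicovitch.exists_disjoint_closedBall_covering_ae μ
    (fun z => {d | H ≤ Ψ.density s z d}) (U ∩ G)
    (fun z hz ε hε => by
      obtain ⟨d, h0, h1, h2⟩ := hz.2.2 ε hε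
      exact ⟨d, h2, h0, h1⟩)
    (fun _ => δ / 2) (fun _ _ => by positivity)
  set T : Set (EuclideanSpace ℝ (Fin n) × ℝ) := (fun z => (z, r z)) '' t with hT
  have hinj : InjOn (fun z => (z, r z)) t := fun x _ y _ h => (Prod.ext_iff.1 h).1
  have hTP : IsPacking δ U T := by
    refine ⟨htc.image _, ?_, ?_, ?_, ?_⟩
    · rintro _ ⟨z, hz, rfl⟩
      exact (htU hz).1
    · rintro _ ⟨z, hz, rfl⟩
      exact (htr z hz).2.1
    · rintro _ ⟨z, hz, rfl⟩
      have := (htr z hz).2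
      exact (Metric.diam_closedBall this.1.le).trans (by linarith [this.2])
    · rintro _ ⟨z, hz, rfl⟩ _ ⟨y, hy, rfl⟩ hzy
      exact htd hz hy fun h => hzy (by rw [h])
  calc H * μ U = H * μ (U ∩ G) := by rw [hUG]
    _ ≤ H * μ (⋃ z ∈ t, Metric.closedBall z (r z)) := by
      gcongr 1
      exact measure_mono_ae (mem_of_superset (compl_mem_ae_iff.2 htμ)
        fun x hx hxU => by_contra fun h => hx ⟨hxU, h⟩)
    _ ≤ H * ∑' z : t, μ (Metric.closedBall (z : EuclideanSpace ℝ (Fin n)) (r z)) := by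
      gcongr
      exact measure_biUnion_le μ htc _
    _ = ∑' z : t, H * μ (Metric.closedBall (z : EuclideanSpace ℝ (Fin n)) (r z)) :=
      ENNReal.tsum_mul_left.symm
    _ ≤ ∑' z : t, ENNReal.ofReal (Metric.diam
        (Metric.closedBall (z : EuclideanSpace ℝ (Fin n)) (r z))) ^ s := by
      refine ENNReal.tsum_le_tsum fun z => ?_
      have hz := htr z z.2
      rw [Metric.diam_closedBall_eq _ hz.2.1.le]
      exact (ENNReal.le_div_iff_mul_le
        (Or.inl (naturalMeasure_closedBall_ne_zero hE hS hs (htU z.2).2.1 hz.2.1))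
        (Or.inl (measure_ne_top _ _))).1 hz.1
    _ = ∑' b : T, ENNReal.ofReal (Metric.diam (Metric.closedBall b.1.1 b.1.2)) ^ s :=
      (tsum_image (fun b : EuclideanSpace ℝ (Fin n) × ℝ =>
        ENNReal.ofReal (Metric.diam (Metric.closedBall b.1 b.2)) ^ s) hinj).symm
    _ ≤ packingDelta s δ U := le_iSup₂_of_le T hTP le_rfl

/-- Near almost every point there are arbitrarily small copies of a ball slightly smaller than
`B(x, d)`, moved slightly: their density is at least almost `h(x, d)`. -/
lemma ae_exists_le_density [NeZero N] (hE : Ψ.IsAttractor E) (hS : Ψ.StrongSeparation E)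
    (hs : ∑ i, Ψ.ratio i ^ s = 1) {x : EuclideanSpace ℝ (Fin n)} (hx : x ∈ E) {d d' : ℝ}
    (hd' : 0 < d') (hdd' : d' < d) (hd : d ≤ Ψ.gap E / Ψ.ratioMin) :
    ∀ᵐ z ∂Ψ.naturalMeasure s, ∀ δ > 0, ∃ r, 0 < r ∧ r < δ ∧
      ENNReal.ofReal (2 * d') ^ s / Ψ.naturalMeasure s (Metric.closedBall x d) ≤
        Ψ.density s z r := by
  obtain ⟨j, hj⟩ : ∃ j, Ψ.ratio j = Ψ.ratioMin := exists_eq_ciInf_of_finite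
  obtain ⟨v, hv⟩ := hE.exists_word_subset_closedBall hx (sub_pos.2 hdd')
  obtain ⟨ρ, h0, h1, hρ⟩ := Ψ.wordRatio_le
  -- The letter of smallest ratio precedes `v`, so that `r_j * d' < c` and the density is invariant.
  filter_upwards [ae_forall_exists_word hE hS hs (j :: v)] with z hz δ hδ
  obtain ⟨k, hk⟩ := exists_pow_lt_of_lt_one (div_pos hδ hd') h1
  obtain ⟨w, hw, y, hy, rfl⟩ := hz k
  have hyE := hE.wordMap_mem v hy
  have hwr : Ψ.wordRatio (w ++ [j]) < δ / d' := by
    refine (hρ _).trans_lt (lt_of_le_of_lt (pow_le_pow_of_le_one h0 h1.le ?_) hk)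
    simp; omega
  refine ⟨Ψ.wordRatio (w ++ [j]) * d', mul_pos (Ψ.wordRatio_pos _) hd', (lt_div_iff₀ hd').1 hwr, ?_⟩
  have hgap : Ψ.ratio j * d' < Ψ.gap E := by
    have hjp := Ψ.ratio_pos j
    rw [← hj, le_div_iff₀ hjp] at hd
    nlinarith
  have heq : Ψ.wordMap (w ++ j :: v) y = Ψ.wordMap (w ++ [j]) (Ψ.wordMap v y) := by
    rw [show w ++ j :: v = (w ++ [j]) ++ v by simp, wordMap_append, Function.comp_apply]
  rw [heq, density_wordMap_eq hE hS hs w j hyE hd' hgap, density]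
  refine ENNReal.div_le_div_left (measure_mono (Metric.closedBall_subset_closedBall' ?_)) _
  have := hv (mem_image_of_mem _ hy)
  rw [Metric.mem_closedBall] at this
  linarith

/-- Every density at a radius up to `c / r_min` is a lower bound of the packing measure. -/
lemma density_le_packingMeasure [NeZero n] [NeZero N] (hE : Ψ.IsAttractor E)
    (hS : Ψ.StrongSeparation E) (hs : ∑ i, Ψ.ratio i ^ s = 1) {x : EuclideanSpace ℝ (Fin n)}
    (hx : x ∈ E) {d : ℝ} (hd0 : 0 < d) (hd : d ≤ Ψ.gap E / Ψ.ratioMin) :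
    Ψ.density s x d ≤ packingMeasure s E := by
  have := isProbabilityMeasure_naturalMeasure hs
  have hpos := naturalMeasure_closedBall_ne_zero hE hS hs hx hd0
  have hlim : Tendsto (fun d' : ℝ =>
      ENNReal.ofReal (2 * d') ^ s / Ψ.naturalMeasure s (Metric.closedBall x d))
      (𝓝[<] d) (𝓝 (Ψ.density s x d)) := by
    have hc : Continuous fun d' : ℝ => ENNReal.ofReal (2 * d') ^ s :=
      ENNReal.continuous_rpow_const.comp (ENNReal.continuous_ofReal.comp (by fun_prop))
    exact (ENNReal.Tendsto.div_const (hc.tendsto d) (Or.inr hpos)).mono_left nhdsWithin_le_nhds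
  refine le_of_tendsto hlim ?_
  filter_upwards [Ioo_mem_nhdsLT hd0] with d' hd'
  refine le_iInf₂ fun U hU => ?_
  calc _ = ENNReal.ofReal (2 * d') ^ s / Ψ.naturalMeasure s (Metric.closedBall x d) *
        Ψ.naturalMeasure s univ := by rw [measure_univ, mul_one]
    _ ≤ ENNReal.ofReal (2 * d') ^ s / Ψ.naturalMeasure s (Metric.closedBall x d) *
        ∑' i, Ψ.naturalMeasure s (U i) := by
      gcongr
      refine (measure_mono_ae ?_).trans (measure_iUnion_le _)
      filter_upwards [hE.ae_mem s] with y hy _ using hU hy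
    _ = ∑' i, ENNReal.ofReal (2 * d') ^ s / Ψ.naturalMeasure s (Metric.closedBall x d) *
        Ψ.naturalMeasure s (U i) := ENNReal.tsum_mul_left.symm
    _ ≤ ∑' i, packingPremeasure s (U i) := ENNReal.tsum_le_tsum fun i =>
      mul_naturalMeasure_le_packingPremeasure hE hS hs
        (ae_exists_le_density hE hS hs hx hd'.1 hd'.2 hd) (U i)

lemma _root_.packingPremeasure_empty (s : ℝ) :
    packingPremeasure s (∅ : Set (EuclideanSpace ℝ (Fin n))) = 0 := by
  refine le_antisymm (iInf₂_le_of_le 1 one_pos (iSup₂_le fun T hT => ?_)) zero_le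
  have : T = ∅ := eq_empty_of_forall_notMem fun b hb => hT.center_mem b hb
  subst this
  simp

/-- A bound for all densities at radii up to `a` bounds the packing measure. -/
lemma packingMeasure_le [NeZero n] (hE : Ψ.IsAttractor E) (hS : Ψ.StrongSeparation E)
    (hs : ∑ i, Ψ.ratio i ^ s = 1) {a : ℝ} (ha : 0 < a) {M : ℝ≥0∞}
    (hM : ∀ x ∈ E, ∀ d, 0 < d → d ≤ a → Ψ.density s x d ≤ M) : packingMeasure s E ≤ M := by
  have := isProbabilityMeasure_naturalMeasure hs
  have h1 : packingMeasure s E ≤ packingPremeasure s E := by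
    refine iInf₂_le_of_le (fun i : ℕ => if i = 0 then E else ∅)
      (fun x hx => mem_iUnion.2 ⟨0, by simpa using hx⟩) ?_
    rw [tsum_eq_single 0 fun i hi => by simp [hi, packingPremeasure_empty]]
    simp
  refine h1.trans (iInf₂_le_of_le (2 * a) (by positivity) (iSup₂_le fun T hT => ?_))
  have hc := hT.countable.to_subtype
  calc ∑' b : T, ENNReal.ofReal (Metric.diam (Metric.closedBall b.1.1 b.1.2)) ^ s
      ≤ ∑' b : T, M * Ψ.naturalMeasure s (Metric.closedBall b.1.1 b.1.2) := by
        refine ENNReal.tsum_le_tsum fun b => ?_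
        have h0 := hT.radius_pos b b.2
        have h2 := hT.diam_le b b.2
        have hx := hT.center_mem b b.2
        rw [Metric.diam_closedBall_eq _ h0.le] at h2 ⊢
        exact (ENNReal.div_le_iff_le_mul
          (Or.inl (naturalMeasure_closedBall_ne_zero hE hS hs hx h0))
          (Or.inl (measure_ne_top _ _))).1 (hM _ hx _ h0 (by linarith))
    _ = M * Ψ.naturalMeasure s (⋃ b ∈ T, Metric.closedBall b.1 b.2) := by
        rw [ENNReal.tsum_mul_left, measure_biUnion hT.countable hT.disjoint
          fun b _ => Metric.isClosed_closedBall.measurableSet]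
    _ ≤ M * 1 := by gcongr; exact prob_le_one
    _ = M := mul_one M

/-! ### Spheres centred in the attractor are null -/

/-- The linear part of the similitude `f_w`, divided by the ratio. -/
lemma exists_linearIsometry (Ψ : SimilitudeSystem n N) (w : List (Fin N)) :
    ∃ L : EuclideanSpace ℝ (Fin n) →ₗᵢ[ℝ] EuclideanSpace ℝ (Fin n),
      ∀ y z, Ψ.wordMap w y - Ψ.wordMap w z = Ψ.wordRatio w • L (y - z) := by
  have hr := Ψ.wordRatio_pos w
  have hi : Isometry fun y => (Ψ.wordRatio w)⁻¹ • Ψ.wordMap w y := by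
    refine Isometry.of_dist_eq fun y z => ?_
    rw [dist_smul₀, dist_wordMap, Real.norm_of_nonneg (by positivity), inv_mul_cancel_left₀ hr.ne']
  refine ⟨hi.affineIsometryOfStrictConvexSpace.linearIsometry, fun y z => ?_⟩
  have h := hi.affineIsometryOfStrictConvexSpace.map_vsub y z
  simp only [vsub_eq_sub, Isometry.affineIsometryOfStrictConvexSpace_apply] at h
  rw [h, ← smul_sub, smul_inv_smul₀ hr.ne']

/-- A closed set of positive measure fills cylinders of arbitrarily high level almost entirely. -/
lemma exists_word_lt_preimage (hE : Ψ.IsAttractor E) (hS : Ψ.StrongSeparation E)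
    (hs : ∑ i, Ψ.ratio i ^ s = 1) {S : Set (EuclideanSpace ℝ (Fin n))} (hSc : IsClosed S)
    (hS0 : Ψ.naturalMeasure s S ≠ 0) (k : ℕ) {q : ℝ≥0∞} (hq : q < 1) :
    ∃ w : List (Fin N), k ≤ w.length ∧ q < Ψ.naturalMeasure s (Ψ.wordMap w ⁻¹' S) := by
  have := isProbabilityMeasure_naturalMeasure hs
  by_contra! h
  have hqt : q ≠ ∞ := (hq.trans ENNReal.one_lt_top).ne
  set μ := Ψ.naturalMeasure s with hμ
  have : IsFiniteMeasure (q • μ) := Measure.smul_finite μ hqt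
  have hle : μ.restrict S (S ∩ E) ≤ (q • μ) (S ∩ E) := by
    refine hS.measure_inter_le hE k (fun w hw => ?_) hSc
    have hm := (hE.isClosed_cylinder w).measurableSet
    rw [Measure.restrict_apply hm, Measure.smul_apply, smul_eq_mul, hμ,
      naturalMeasure_cylinder hE hS hs w,
      ← wordWeight_mul_eq hE hS hs w (hm.inter hSc.measurableSet)
        (inter_subset_left.trans inter_subset_left), mul_comm q]
    refine mul_le_mul_right ((measure_mono ?_).trans (h w hw)) _
    exact preimage_mono inter_subset_right
  rw [Measure.restrict_apply (hSc.inter hE.isCompact.isClosed).measurableSet,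
    inter_eq_left.2 inter_subset_left, Measure.smul_apply, smul_eq_mul, hμ,
    naturalMeasure_inter hE] at hle
  refine absurd hle (not_le.2 ?_)
  calc q * μ S < 1 * μ S := ENNReal.mul_lt_mul_left hS0 (measure_ne_top _ _) hq
    _ = μ S := one_mul _

lemma naturalMeasure_sphere (hE : Ψ.IsAttractor E) (hS : Ψ.StrongSeparation E)
    (hs : ∑ i, Ψ.ratio i ^ s = 1) {x : EuclideanSpace ℝ (Fin n)} (hx : x ∈ E) {d : ℝ}
    (hd : 0 < d) : Ψ.naturalMeasure s (Metric.sphere x d) = 0 := by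
  have := isProbabilityMeasure_naturalMeasure hs
  by_contra h0
  set μ := Ψ.naturalMeasure s with hμ
  have hSc : IsClosed (Metric.sphere x d) := Metric.isClosed_sphere
  -- Cylinders that the sphere fills up to a summable proportion.
  have hw : ∀ k : ℕ, ∃ w : List (Fin N), k ≤ w.length ∧
      μ (Ψ.wordMap w ⁻¹' Metric.sphere x d)ᶜ ≤ 2⁻¹ ^ k := by
    intro k
    obtain ⟨w, hk, hw⟩ := exists_word_lt_preimage hE hS hs hSc h0 k
      (q := 1 - 2⁻¹ ^ k) (ENNReal.sub_lt_self (by simp) (by simp) (by simp))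
    refine ⟨w, hk, ?_⟩
    rw [prob_compl_eq_one_sub (hSc.preimage (Ψ.continuous_wordMap w)).measurableSet,
      tsub_le_iff_left]
    exact tsub_le_iff_right.1 hw.le
  choose w hwk hwμ using hw
  have hev : ∀ᵐ y ∂μ, ∀ᶠ k in atTop, dist (Ψ.wordMap (w k) y) x = d := by
    have hsum : ∑' k, μ (Ψ.wordMap (w k) ⁻¹' Metric.sphere x d)ᶜ ≠ ∞ :=
      ne_top_of_le_ne_top (by rw [ENNReal.tsum_geometric_two]; simp) (ENNReal.tsum_le_tsum hwμ)
    filter_upwards [ae_eventually_notMem hsum] with y hy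
    filter_upwards [hy] with k hk
    exact not_not.1 hk
  obtain ⟨z, hzE, hz⟩ := ((hE.ae_mem s).and hev).exists
  -- The direction of the affine span of the attractor, which the linear parts of `f_w` preserve.
  set V : Submodule ℝ (EuclideanSpace ℝ (Fin n)) :=
    Submodule.span ℝ ((fun y => y - z) '' E) with hV
  have hVsub : ∀ y ∈ E, ∀ y' ∈ E, y - y' ∈ V := by
    intro y hy y' hy'
    have := V.sub_mem (Submodule.subset_span (mem_image_of_mem _ hy))
      (Submodule.subset_span (mem_image_of_mem _ hy'))
    simpa using this
  choose L hL using fun k => Ψ.exists_linearIsometry (w k)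
  have hu : ∀ k, ∃ u ∈ V, L k u = Ψ.wordMap (w k) z - x := by
    intro k
    have hr := Ψ.wordRatio_pos (w k)
    have hle : V.map (L k).toLinearMap ≤ V := by
      rw [hV, Submodule.map_span, Submodule.span_le, ← hV]
      rintro _ ⟨_, ⟨y, hy, rfl⟩, rfl⟩
      have h1 := V.smul_mem (Ψ.wordRatio (w k))⁻¹
        (hVsub _ (hE.wordMap_mem (w k) hy) _ (hE.wordMap_mem (w k) hzE))
      rwa [hL, inv_smul_smul₀ hr.ne'] at h1
    have heq : V.map (L k).toLinearMap = V := by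
      refine Submodule.eq_of_le_of_finrank_eq hle ?_
      exact LinearEquiv.finrank_map_eq ((L k).toLinearIsometryEquiv rfl).toLinearEquiv V
    have hmem : Ψ.wordMap (w k) z - x ∈ V.map (L k).toLinearMap := by
      rw [heq]
      exact hVsub _ (hE.wordMap_mem (w k) hzE) _ hx
    obtain ⟨u, hu, hue⟩ := hmem
    exact ⟨u, hu, hue⟩
  choose u huV huL using hu
  have hun : ∀ k, ‖u k‖ = dist (Ψ.wordMap (w k) z) x := fun k => by
    rw [dist_eq_norm, ← huL, (L k).norm_map]
  obtain ⟨u₀, hu₀, φ, hφ, hlim⟩ := (isCompact_closedBall (0 : EuclideanSpace ℝ (Fin n))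
    (Metric.diam E)).tendsto_subseq (x := u) fun k => by
      rw [mem_closedBall_zero_iff, hun]
      exact Metric.dist_le_diam_of_mem hE.isCompact.isBounded (hE.wordMap_mem _ hzE) hx
  have hu₀V : u₀ ∈ V := V.closed_of_finiteDimensional.mem_of_tendsto hlim
    (Eventually.of_forall fun k => huV (φ k))
  have hu₀n : ‖u₀‖ = d := by
    refine tendsto_nhds_unique hlim.norm ?_
    refine tendsto_const_nhds.congr' ?_
    filter_upwards [hφ.tendsto_atTop.eventually hz] with k hk
    rw [Function.comp_apply, hun, hk]
  have hr0 : Tendsto (fun k => Ψ.wordRatio (w (φ k))) atTop (𝓝 0) := by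
    obtain ⟨ρ, h0, h1, hρ⟩ := Ψ.wordRatio_le
    refine squeeze_zero (fun k => (Ψ.wordRatio_pos _).le)
      (fun k => (hρ _).trans (pow_le_pow_of_le_one h0 h1.le (hwk (φ k)))) ?_
    exact (tendsto_pow_atTop_nhds_zero_of_lt_one h0 h1).comp hφ.tendsto_atTop
  -- The rescaled spheres flatten to a hyperplane with normal `u₀`, which carries the measure.
  have hae : ∀ᵐ y ∂μ, inner ℝ (y - z) u₀ = 0 := by
    filter_upwards [hev] with y hy
    have hlim1 : Tendsto (fun k => Ψ.wordRatio (w (φ k)) * ‖y - z‖ ^ 2 +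
        2 * inner ℝ (y - z) (u (φ k))) atTop (𝓝 (0 * ‖y - z‖ ^ 2 + 2 * inner ℝ (y - z) u₀)) :=
      (hr0.mul_const _).add ((tendsto_const_nhds.inner hlim).const_mul 2)
    have hlim2 : 0 * ‖y - z‖ ^ 2 + 2 * inner ℝ (y - z) u₀ = 0 := by
      refine tendsto_nhds_unique hlim1 (tendsto_const_nhds.congr' ?_)
      filter_upwards [hφ.tendsto_atTop.eventually hz, hφ.tendsto_atTop.eventually hy]
        with k hkz hky
      have hr := Ψ.wordRatio_pos (w (φ k))
      have h1 : Ψ.wordMap (w (φ k)) y - x =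
          L (φ k) (Ψ.wordRatio (w (φ k)) • (y - z) + u (φ k)) := by
        rw [map_add, map_smul, huL, ← hL]
        abel
      have h2 : ‖Ψ.wordRatio (w (φ k)) • (y - z) + u (φ k)‖ = d := by
        rw [← (L (φ k)).norm_map, ← h1, ← dist_eq_norm, hky]
      have h3 : ‖u (φ k)‖ = d := by rw [hun, hkz]
      have h4 := norm_add_sq_real (Ψ.wordRatio (w (φ k)) • (y - z)) (u (φ k))
      rw [h2, h3, norm_smul, Real.norm_of_nonneg hr.le, real_inner_smul_left] at h4
      have h5 : Ψ.wordRatio (w (φ k)) * (Ψ.wordRatio (w (φ k)) * ‖y - z‖ ^ 2 +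
          2 * inner ℝ (y - z) (u (φ k))) = 0 := by linarith
      exact ((mul_eq_zero.1 h5).resolve_left hr.ne').symm
    linarith
  have hall : ∀ y ∈ E, inner ℝ (y - z) u₀ = 0 := by
    intro y hy
    by_contra hne
    have hopen : IsOpen {y : EuclideanSpace ℝ (Fin n) | inner ℝ (y - z) u₀ ≠ 0} :=
      isOpen_ne_fun (by fun_prop) continuous_const
    obtain ⟨ε, hε, hsub⟩ := Metric.nhds_basis_closedBall.mem_iff.1 (hopen.mem_nhds hne)
    exact naturalMeasure_closedBall_ne_zero hE hS hs hy hε (measure_mono_null hsub hae)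
  have hperp : V ≤ (ℝ ∙ u₀)ᗮ := by
    rw [hV, Submodule.span_le]
    rintro _ ⟨y, hy, rfl⟩
    exact Submodule.mem_orthogonal_singleton_iff_inner_left.2 (hall y hy)
  have hzero : inner ℝ u₀ u₀ = 0 :=
    Submodule.mem_orthogonal_singleton_iff_inner_left.1 (hperp hu₀V)
  rw [inner_self_eq_zero] at hzero
  rw [hzero, norm_zero] at hu₀n
  exact hd.ne hu₀n

/-! ### The density attains its maximum -/

lemma continuousOn_density (hE : Ψ.IsAttractor E) (hS : Ψ.StrongSeparation E)
    (hs : ∑ i, Ψ.ratio i ^ s = 1) :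
    ContinuousOn (fun p : EuclideanSpace ℝ (Fin n) × ℝ => Ψ.density s p.1 p.2)
      (E ×ˢ Ioi 0) := by
  have := isProbabilityMeasure_naturalMeasure hs
  rintro ⟨x, d⟩ ⟨hx, hd⟩
  refine ContinuousAt.continuousWithinAt ?_
  have hd : 0 < d := hd
  have hball : Tendsto (fun p : EuclideanSpace ℝ (Fin n) × ℝ =>
      Ψ.naturalMeasure s (Metric.closedBall p.1 p.2)) (𝓝 (x, d))
      (𝓝 (Ψ.naturalMeasure s (Metric.closedBall x d))) := by
    refine tendsto_measure_of_ae_tendsto_indicator_of_isFiniteMeasure _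
      Metric.isClosed_closedBall.measurableSet
      (fun _ => Metric.isClosed_closedBall.measurableSet) ?_
    have hae : ∀ᵐ y ∂Ψ.naturalMeasure s, y ∉ Metric.sphere x d :=
      compl_mem_ae_iff.2 (naturalMeasure_sphere hE hS hs hx hd)
    filter_upwards [hae] with y hy
    have hc1 : Continuous fun p : EuclideanSpace ℝ (Fin n) × ℝ => dist y p.1 := by fun_prop
    simp only [Metric.mem_closedBall]
    rcases lt_or_gt_of_ne (show dist y x ≠ d from hy) with h | h
    · filter_upwards [hc1.continuousAt.eventually_lt continuousAt_snd h] with p hp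
      exact iff_of_true hp.le h.le
    · filter_upwards [continuousAt_snd.eventually_lt hc1.continuousAt h] with p hp
      exact iff_of_false hp.not_ge h.not_ge
  have hnum : Continuous fun p : EuclideanSpace ℝ (Fin n) × ℝ => ENNReal.ofReal (2 * p.2) ^ s :=
    ENNReal.continuous_rpow_const.comp (ENNReal.continuous_ofReal.comp (by fun_prop))
  exact ENNReal.Tendsto.div (hnum.tendsto (x, d))
    (Or.inr (naturalMeasure_closedBall_ne_zero hE hS hs hx hd)) hball (Or.inl (measure_ne_top _ _))

/-- A ball of radius below `a * r_min` centred in the attractor can be blown up by inverses of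
the `f_i` until its radius lies in `[a * r_min, a]`, without decreasing the density. -/
lemma exists_density_le (hE : Ψ.IsAttractor E) (hS : Ψ.StrongSeparation E)
    (hs : ∑ i, Ψ.ratio i ^ s = 1) {a d : ℝ} {x : EuclideanSpace ℝ (Fin n)} (hx : x ∈ E)
    (ha : 0 < a) (hd : 0 < d) (hda : d ≤ a) :
    ∃ y ∈ E, ∃ r, a * Ψ.ratioMin ≤ r ∧ r ≤ a ∧ Ψ.density s x d ≤ Ψ.density s y r := by
  obtain ⟨ρ, h0, h1, hρ⟩ := Ψ.wordRatio_le
  obtain ⟨k, hk⟩ := exists_pow_lt_of_lt_one (div_pos hd ha) h1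
  replace hk : a * ρ ^ k ≤ d := by rw [mul_comm]; exact ((lt_div_iff₀ ha).1 hk).le
  induction k generalizing x d with
  | zero =>
    obtain rfl : d = a := le_antisymm hda (by simpa using hk)
    obtain ⟨i, -⟩ := hE.exists_map_eq hx
    exact ⟨x, hx, d, mul_le_of_le_one_right ha.le
      ((Ψ.ratioMin_le i).trans (Ψ.ratio_lt_one i).le), le_rfl, le_rfl⟩
  | succ k ih =>
    rcases le_or_gt (a * Ψ.ratioMin) d with h | h
    · exact ⟨x, hx, d, h, hda, le_rfl⟩
    obtain ⟨i, y, hy, rfl⟩ := hE.exists_map_eq hx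
    have hr := Ψ.ratio_pos i
    have hi : Ψ.ratio i ≤ ρ := by simpa [wordRatio] using hρ [i]
    have hdi : 0 < d / Ψ.ratio i := div_pos hd hr
    obtain ⟨z, hz, r, hr1, hr2, hr3⟩ := ih hy hdi
      ((div_le_iff₀ hr).2 (h.le.trans (mul_le_mul_of_nonneg_left (Ψ.ratioMin_le i) ha.le)))
      ((le_div_iff₀ hr).2 (le_trans (by
        rw [pow_succ, ← mul_assoc]
        gcongr) hk))
    refine ⟨z, hz, r, hr1, hr2, le_trans ?_ hr3⟩
    have := density_wordMap_le hE hS hs [i] y hdi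
    rwa [wordRatio_singleton, mul_div_cancel₀ _ hr.ne'] at this

end SimilitudeSystem

theorem theorem1 {n N : ℕ} (hN : 2 ≤ N) (Ψ : SimilitudeSystem n N)
    (E : Set (EuclideanSpace ℝ (Fin n))) (hE : Ψ.IsAttractor E) (hSSC : Ψ.StrongSeparation E)
    (s : ℝ) (hs : ∑ i, Ψ.ratio i ^ s = 1)
    (a : ℝ) (ha : 0 < a) (hac : a ≤ Ψ.gap E / Ψ.ratioMin) :
    IsGreatest {t | ∃ x ∈ E, ∃ d : ℝ, 0 < d ∧ d ≤ a ∧ t = Ψ.density s x d}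
      (packingMeasure s E) ∧
    IsGreatest {t | ∃ x ∈ E, ∃ d : ℝ, a * Ψ.ratioMin ≤ d ∧ d ≤ a ∧ t = Ψ.density s x d}
      (packingMeasure s E) := by
  have : NeZero n := ⟨SimilitudeSystem.ne_zero_of_strongSeparation hN hE hSSC⟩
  have : NeZero N := ⟨by omega⟩
  have hmin : 0 < Ψ.ratioMin := by
    obtain ⟨j, hj⟩ : ∃ j, Ψ.ratio j = Ψ.ratioMin := exists_eq_ciInf_of_finite
    exact hj ▸ Ψ.ratio_pos j
  have hamin : 0 < a * Ψ.ratioMin := mul_pos ha hmin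
  have hle : ∀ x ∈ E, ∀ d, 0 < d → d ≤ a → Ψ.density s x d ≤ packingMeasure s E :=
    fun x hx d hd hda =>
      SimilitudeSystem.density_le_packingMeasure hE hSSC hs hx hd (hda.trans hac)
  obtain ⟨x₀, hx₀⟩ := hE.nonempty
  obtain ⟨y₀, hy₀, r₀, hr₀, hr₀a, -⟩ :=
    SimilitudeSystem.exists_density_le hE hSSC hs hx₀ ha ha le_rfl
  obtain ⟨⟨x, d⟩, ⟨hx, hd⟩, hmax⟩ :=
    (hE.isCompact.prod (isCompact_Icc (a := a * Ψ.ratioMin) (b := a))).exists_isMaxOn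
      ⟨(y₀, r₀), hy₀, hr₀, hr₀a⟩ ((SimilitudeSystem.continuousOn_density hE hSSC hs).mono
        (prod_mono_right fun d hd => hamin.trans_le hd.1))
  have heq : packingMeasure s E = Ψ.density s x d := by
    refine le_antisymm (SimilitudeSystem.packingMeasure_le hE hSSC hs ha ?_)
      (hle x hx d (hamin.trans_le hd.1) hd.2)
    intro y hy r hr hra
    obtain ⟨z, hz, t, ht, hta, hyz⟩ :=
      SimilitudeSystem.exists_density_le hE hSSC hs hy ha hr hra
    exact hyz.trans (hmax (show (z, t) ∈ E ×ˢ Icc (a * Ψ.ratioMin) a from ⟨hz, ht, hta⟩))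
  refine ⟨⟨⟨x, hx, d, hamin.trans_le hd.1, hd.2, heq⟩, ?_⟩, ⟨x, hx, d, hd.1, hd.2, heq⟩, ?_⟩
  · rintro _ ⟨y, hy, r, hr, hra, rfl⟩
    exact hle y hy r hr hra
  · rintro _ ⟨y, hy, r, hr, hra, rfl⟩
    exact hle y hy r (hamin.trans_le hr) hra
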